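/- Let $G$ be a locally finite, weakly connected digraph (parallel edges are allowed, loops are not), with vertex set $V(G)$, set of directed edges $E(G)$, and set of ends $\Omega(G)$, the ends being those of the underlying undirected multigraph. Let $|G|$ be the Freudenthal compactification of the $1$-complex of that multigraph; its points are the vertices, the ends and the inner points of the edges of $G$. For $e\in E(G)$ let $\mathring e\subseteq |G|$ be the set of inner points of $e$, linearly ordered by $<_e$ from the tail of $e$ to its head, and let $\mathring E=\bigcup_{e\in E(G)}\mathring e$. A *topological walk* in $|G|$ is a pair $(W,<_W)$ of a set $W\subseteq |G|$ and a linear order $<_W$ on $\mathring E\cap W$ that has a *witness*: a continuous map $\sigma\colon[0,1]\to|G|$ with image $W$ such that every $p\in\mathring E\cap W$ has precisely one preimage under $\sigma$, and such that $p<_W q$ if and only if $\sigma^{-1}(p)<\sigma^{-1}(q)$, for all $p,q\in\mathring E\cap W$. It is *directed* if $<_W$ and $<_e$ agree on $\mathring e$ for every edge $e$ with $\mathring e\cap W\neq\emptyset$. It is a *directed topological $s$–$t$ walk* if it is directed and has a witness $\sigma$ with $\sigma(0)=s$ and $\sigma(1)=t$. A *directed $s$–$t$ arc* is a set $A\subseteq|G|$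 that is the image of a homeomorphic embedding $\sigma\colon[0,1]\to|G|$ with $\sigma(0)=s$ and $\sigma(1)=t$ which is a witness of a directed topological walk $(A,<_A)$ for some linear order $<_A$ on $\mathring E\cap A$. Let $s,t\in V(G)\cup\Omega(G)$ with $s\neq t$. Then for every directed topological $s$–$t$ walk $(W,<_W)$ in $|G|$ there is a directed $s$–$t$ arc $A\subseteq W$. -/

import Mathlib

/-- A digraph with vertex set `V` and edge set `E`; parallel edges are allowed, loops are not. -/
structure MultiDigraph (V E : Type*) where
  /-- the tail of an edge -/
  tail : E → V
  /-- the head of an edge -/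
  head : E → V
  tail_ne_head : ∀ e, tail e ≠ head e

namespace MultiDigraph

variable {V E : Type*}

/-- Every vertex is incident with only finitely many edges. -/
def LocallyFinite (G : MultiDigraph V E) : Prop :=
  ∀ v : V, {e : E | G.tail e = v ∨ G.head e = v}.Finite

/-- The edge `e` joins `u` and `v` in the underlying undirected multigraph. -/
def Joins (G : MultiDigraph V E) (e : E) (u v : V) : Prop :=
  (G.tail e = u ∧ G.head e = v) ∨ (G.tail e = v ∧ G.head e = u)

/-- The adjacency relation of the underlying undirected multigraph, as a simple graph.
It is used only to speak about connectedness. -/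
def adjGraph (G : MultiDigraph V E) : SimpleGraph V where
  Adj u v := ∃ e, G.Joins e u v
  symm := ⟨fun _ _ ⟨e, he⟩ => ⟨e, he.symm⟩⟩
  loopless := ⟨fun _ ⟨e, he⟩ => G.tail_ne_head e
    (he.elim (fun h => h.1.trans h.2.symm) (fun h => h.1.trans h.2.symm))⟩

/-- A digraph is weakly connected if its underlying multigraph is connected
(in particular, it has a vertex). -/
def WeaklyConnected (G : MultiDigraph V E) : Prop := G.adjGraph.Connected

/-- `u` and `v` are vertices of the same component of the undirected multigraph `G - S`. -/
def JoinedOff (G : MultiDigraph V E) (S : Finset V) (u v : V) : Prop :=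
  ∃ p : G.adjGraph.Walk u v, ∀ w ∈ p.support, w ∉ S

/-- A ray: a one-way infinite path in the underlying undirected multigraph. -/
structure Ray (G : MultiDigraph V E) where
  /-- the vertices of the ray, in order -/
  vert : ℕ → V
  /-- the edges of the ray, in order -/
  edge : ℕ → E
  injective_vert : Function.Injective vert
  joins : ∀ n, G.Joins (edge n) (vert n) (vert (n + 1))

/-- Two rays are equivalent if no finite vertex set separates them: for every finite `S`,
both have a tail in the same component of `G - S`. -/
def Ray.Equivalent {G : MultiDigraph V E} (R R' : G.Ray) : Prop :=
  ∀ S : Finset V, ∃ N : ℕ, ∀ m ≥ N, ∀ n ≥ N, G.JoinedOff S (R.vert m) (R'.vert n)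

theorem JoinedOff.symm {G : MultiDigraph V E} {S : Finset V} {u v : V}
    (h : G.JoinedOff S u v) : G.JoinedOff S v u := by
  obtain ⟨p, hp⟩ := h
  exact ⟨p.reverse, fun w hw => hp w (by simpa using hw)⟩

theorem JoinedOff.trans {G : MultiDigraph V E} {S : Finset V} {u v w : V}
    (h : G.JoinedOff S u v) (h' : G.JoinedOff S v w) : G.JoinedOff S u w := by
  obtain ⟨p, hp⟩ := h
  obtain ⟨q, hq⟩ := h'
  refine ⟨p.append q, fun x hx => ?_⟩
  rcases (SimpleGraph.Walk.mem_support_append_iff p q).1 hx with h | h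
  · exact hp x h
  · exact hq x h

/-- Every ray is equivalent to itself. -/
theorem Ray.equivalent_refl {G : MultiDigraph V E} (R : G.Ray) : R.Equivalent R := by
  intro S
  have hfin : {n : ℕ | R.vert n ∈ S}.Finite :=
    Set.Finite.preimage R.injective_vert.injOn S.finite_toSet
  obtain ⟨M, hM⟩ := hfin.bddAbove
  have hout : ∀ n ≥ M + 1, R.vert n ∉ S := fun n hn hS => by
    have : n ≤ M := hM hS
    omega
  have step : ∀ k m, M + 1 ≤ m → G.JoinedOff S (R.vert m) (R.vert (m + k)) := by
    intro k
    induction k with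
    | zero =>
      intro m hm
      exact ⟨SimpleGraph.Walk.nil, fun w hw => by
        have : w = R.vert m := by simpa using hw
        exact this ▸ hout m hm⟩
    | succ k ih =>
      intro m hm
      have hadj : G.adjGraph.Adj (R.vert (m + k)) (R.vert (m + k + 1)) := ⟨_, R.joins (m + k)⟩
      refine (ih m hm).trans ⟨SimpleGraph.Walk.cons hadj SimpleGraph.Walk.nil, fun w hw => ?_⟩
      have hw' : w = R.vert (m + k) ∨ w = R.vert (m + k + 1) := by simpa using hw
      rcases hw' with rfl | rfl
      · exact hout _ (by omega)
      · exact hout _ (by omega)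
  refine ⟨M + 1, fun m hm n hn => ?_⟩
  rcases le_total m n with h | h
  · obtain ⟨k, rfl⟩ := Nat.exists_eq_add_of_le h
    exact step k m hm
  · obtain ⟨k, rfl⟩ := Nat.exists_eq_add_of_le h
    exact (step k n hn).symm

/-- Equivalence of rays. -/
def raySetoid (G : MultiDigraph V E) : Setoid G.Ray where
  r := Ray.Equivalent
  iseqv :=
    { refl := Ray.equivalent_refl
      symm := fun h S => by
        obtain ⟨N, hN⟩ := h S
        exact ⟨N, fun m hm n hn => (hN n hn m hm).symm⟩
      trans := fun h h' S => by
        obtain ⟨N, hN⟩ := h S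
        obtain ⟨M, hM⟩ := h' S
        exact ⟨max N M, fun m hm n hn =>
          (hN m (le_trans (le_max_left _ _) hm) (max N M) (le_max_left _ _)).trans
            (hM (max N M) (le_max_right _ _) n (le_trans (le_max_right _ _) hn))⟩ }

/-- The ends of a digraph: the equivalence classes of rays of its underlying multigraph. -/
def Ends (G : MultiDigraph V E) : Type _ := Quotient G.raySetoid

/-- The end that contains the ray `R`. -/
def Ray.toEnd {G : MultiDigraph V E} (R : G.Ray) : G.Ends := Quotient.mk G.raySetoid R

/-- The vertex set of the component `C(S, ω)` of `G - S` that contains a tail of every ray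
of the end `ω`. -/
def endComp (G : MultiDigraph V E) (S : Finset V) (ω : G.Ends) : Set V :=
  {v | ∃ R : G.Ray, R.toEnd = ω ∧ ∃ N : ℕ, ∀ n ≥ N, G.JoinedOff S v (R.vert n)}

/-- The points of `|G|`: the vertices, the inner points of edges, and the ends of `G`.
The inner points of `e` are parametrised by the open unit interval, from the tail of `e` (at `0`)
to the head of `e` (at `1`). -/
inductive Point (G : MultiDigraph V E) : Type _
  | vertex (v : V) : Point G
  | inner (e : E) (x : Set.Ioo (0 : ℝ) 1) : Point G
  | limit (ω : G.Ends) : Point G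

/-- The open star around the vertex `v` that contains, of every edge `e` at `v`,
the half-open segment of length `ε e` starting in `v`. -/
def openStar (G : MultiDigraph V E) (v : V) (ε : E → ℝ) : Set G.Point :=
  {Point.vertex v}
    ∪ {p | ∃ e x, p = Point.inner e x ∧ G.tail e = v ∧ (x : ℝ) < ε e}
    ∪ {p | ∃ e x, p = Point.inner e x ∧ G.head e = v ∧ 1 - (x : ℝ) < ε e}

/-- The basic open neighbourhood of the end `ω` given by the finite vertex set `S`. It consists of
the vertices of the component `C = C(S, ω)` of `G - S`, all inner points of edges of `C` and of
edges between `C` and `S`, and all ends with rays in `C`. -/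
def endNhd (G : MultiDigraph V E) (S : Finset V) (ω : G.Ends) : Set G.Point :=
  {p | ∃ v ∈ G.endComp S ω, p = Point.vertex v}
    ∪ {p | ∃ e x, p = Point.inner e x ∧ (G.tail e ∈ G.endComp S ω ∨ G.head e ∈ G.endComp S ω)}
    ∪ {p | ∃ ω' : G.Ends, p = Point.limit ω' ∧ G.endComp S ω' = G.endComp S ω}

/-- The topology of `|G|`, the Freudenthal compactification of the `1`-complex of a locally finite
connected `G`: it is generated by the open sets of inner points of single edges, the open stars
around vertices, and the basic open neighbourhoods of ends. -/
instance (G : MultiDigraph V E) : TopologicalSpace G.Point :=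
  TopologicalSpace.generateFrom
    ({U | ∃ (e : E) (J : Set (Set.Ioo (0 : ℝ) 1)), IsOpen J ∧ U = Point.inner e '' J}
      ∪ {U | ∃ (v : V) (ε : E → ℝ), (∀ e, 0 < ε e) ∧ U = G.openStar v ε}
      ∪ {U | ∃ (S : Finset V) (ω : G.Ends), U = G.endNhd S ω})

/-- The subset `V(G) ∪ Ω(G)` of `|G|`. -/
def verticesAndEnds (G : MultiDigraph V E) : Set G.Point :=
  Set.range Point.vertex ∪ Set.range Point.limit

/-- The set of the inner points of the edge `e`. -/
def edgeInterior (G : MultiDigraph V E) (e : E) : Set G.Point := Set.range (Point.inner e)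

/-- The set of all inner points of edges. -/
def innerPoints (G : MultiDigraph V E) : Set G.Point := ⋃ e, G.edgeInterior e

/-- The linear order on the inner points of the edge `e` given by its direction from tail to
head. -/
def EdgeLT (G : MultiDigraph V E) (e : E) (p q : G.Point) : Prop :=
  ∃ x y : Set.Ioo (0 : ℝ) 1, p = Point.inner e x ∧ q = Point.inner e y ∧ x < y

/-- The continuous map `σ : [0,1] → |G|` witnesses that `(W, <_W)` is a topological walk in `|G|`,
where the linear order `<_W`, called `lt` here, is one on the set of those inner points of edges
that lie in `W`. -/
structure IsWitness (G : MultiDigraph V E) (σ : C(unitInterval, G.Point)) (W : Set G.Point)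
    (lt : ↥(G.innerPoints ∩ W) → ↥(G.innerPoints ∩ W) → Prop) : Prop where
  isStrictTotalOrder : IsStrictTotalOrder ↥(G.innerPoints ∩ W) lt
  range_eq : Set.range σ = W
  existsUnique_preimage : ∀ p ∈ G.innerPoints ∩ W, ∃! a, σ a = p
  lt_iff : ∀ p q : ↥(G.innerPoints ∩ W), lt p q ↔ ∃ a b, σ a = p ∧ σ b = q ∧ a < b

/-- The order `<_W` agrees with the direction of every edge that has an inner point in `W`. -/
def DirectedAlongEdges (G : MultiDigraph V E) (W : Set G.Point)
    (lt : ↥(G.innerPoints ∩ W) → ↥(G.innerPoints ∩ W) → Prop) : Prop :=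
  ∀ e : E, ∀ p q : ↥(G.innerPoints ∩ W), (p : G.Point) ∈ G.edgeInterior e →
    (q : G.Point) ∈ G.edgeInterior e → (lt p q ↔ G.EdgeLT e p q)

/-- `(W, <_W)` is a directed topological `s`–`t` walk in `|G|`. -/
def IsDirectedTopWalk (G : MultiDigraph V E) (W : Set G.Point)
    (lt : ↥(G.innerPoints ∩ W) → ↥(G.innerPoints ∩ W) → Prop) (s t : G.Point) : Prop :=
  G.DirectedAlongEdges W lt ∧
    ∃ σ : C(unitInterval, G.Point), G.IsWitness σ W lt ∧ σ 0 = s ∧ σ 1 = t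

/-- `A` is a directed `s`–`t` arc in `|G|`: the image of a homeomorphic embedding of `[0,1]` which
maps `0` to `s` and `1` to `t` and which is a witness of a directed topological walk on `A`. -/
def IsDirectedArc (G : MultiDigraph V E) (A : Set G.Point) (s t : G.Point) : Prop :=
  ∃ lt : ↥(G.innerPoints ∩ A) → ↥(G.innerPoints ∩ A) → Prop, G.DirectedAlongEdges A lt ∧
    ∃ σ : C(unitInterval, G.Point), Topology.IsEmbedding σ ∧ G.IsWitness σ A lt ∧
      σ 0 = s ∧ σ 1 = t

end MultiDigraph

/-! A path `σ` with distinct end points in a Hausdorff space contains an arc that meets its points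
in the order in which `σ` does: it has the form `σ ∘ ψ` with `ψ` strictly increasing
(`exists_strictMono_isEmbedding_comp`). This is applied to a witness of `W`, since `|G|` is
Hausdorff (`LocallyFinite.t2Space`). Inner points of edges have only one preimage under `σ`, so the
order along the arc is the restriction of that of `W`, and the arc inherits its directedness.

To find the arc, consider the closed sets `K` of times such that both ends of each gap have the same
image. By compactness and Zorn's lemma there is a minimal one, and in it no time lies strictly
between two times with the same image. Skipping its gaps turns `σ` into a path `τ` with order-convex
fibres (`exists_shortening`). A series of running maxima of Urysohn functions is a monotone real
function with exactly the same fibres (`exists_monotone_real`), and inverting it reparametrises `τ`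
as an arc. -/

namespace ArcOfPath

open Set Topology

variable {X : Type*}

/-! ### Shortcuts of a path -/

/-- `K` is a closed set of times such that skipping the gaps of `K` turns the path `σ` into a
path again: both boundary points of each gap have the same image. -/
structure IsShortcut (σ : unitInterval → X) (K : Set unitInterval) : Prop where
  isClosed : IsClosed K
  exists_gap : ∀ x, ∃ a b, a ≤ x ∧ x ≤ b ∧ a ∈ K ∧ b ∈ K ∧ σ a = σ b ∧ ∀ c ∈ K, ¬ (a < c ∧ c < b)

theorem isShortcut_univ (σ : unitInterval → X) : IsShortcut σ univ :=
  ⟨isClosed_univ, fun x => ⟨x, x, le_rfl, le_rfl, trivial, trivial, rfl,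
    fun _ _ h => lt_asymm h.1 h.2⟩⟩

/-- Around a fixed time, the admissible pairs of gap ends form nonempty compact sets that shrink
along the chain, so one pair serves all members. -/
theorem IsShortcut.sInter [TopologicalSpace X] [T2Space X] {σ : unitInterval → X} (hσ : Continuous σ)
    {c : Set (Set unitInterval)} (hc : ∀ K ∈ c, IsShortcut σ K) (hchain : IsChain (· ⊆ ·) c)
    (hne : c.Nonempty) : IsShortcut σ (⋂₀ c) := by
  refine ⟨isClosed_sInter fun K hK => (hc K hK).isClosed, fun x => ?_⟩
  -- The gap condition refers to `⋂₀ c` instead of `K`: this makes `P` monotone in `K`.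
  let P : Set unitInterval → Set (unitInterval × unitInterval) := fun K =>
    {p | p.1 ≤ x} ∩ {p | x ≤ p.2} ∩ (Prod.fst ⁻¹' K) ∩ (Prod.snd ⁻¹' K) ∩ {p | σ p.1 = σ p.2} ∩
      ⋂ z ∈ ⋂₀ c, ({p | z ≤ p.1} ∪ {p | p.2 ≤ z})
  have hPclosed : ∀ K ∈ c, IsClosed (P K) := fun K hK => by
    refine IsClosed.inter (IsClosed.inter (IsClosed.inter (IsClosed.inter (IsClosed.inter
      (isClosed_le continuous_fst continuous_const) (isClosed_le continuous_const continuous_snd))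
      ((hc K hK).isClosed.preimage continuous_fst)) ((hc K hK).isClosed.preimage continuous_snd))
      (isClosed_eq (hσ.comp continuous_fst) (hσ.comp continuous_snd))) ?_
    exact isClosed_biInter fun z _ => (isClosed_le continuous_const continuous_fst).union
      (isClosed_le continuous_snd continuous_const)
  have hPne : ∀ K ∈ c, (P K).Nonempty := fun K hK => by
    obtain ⟨a, b, hax, hxb, ha, hb, hab, hgap⟩ := (hc K hK).exists_gap x
    refine ⟨(a, b), ⟨⟨⟨⟨⟨hax, hxb⟩, ha⟩, hb⟩, hab⟩, ?_⟩⟩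
    refine mem_iInter₂.2 fun z hz => ?_
    have := hgap z (hz K hK)
    by_contra hcon
    simp only [mem_union, mem_ofPred_eq, not_or, not_le] at hcon
    exact this hcon
  have hPmono : ∀ K L : Set unitInterval, K ⊆ L → P K ⊆ P L := by
    rintro K L h p ⟨⟨⟨⟨hp, h1⟩, h2⟩, h3⟩, h4⟩
    exact ⟨⟨⟨⟨hp, h h1⟩, h h2⟩, h3⟩, h4⟩
  obtain ⟨K₀, hK₀⟩ := hne
  have : Nonempty c := ⟨⟨K₀, hK₀⟩⟩
  obtain ⟨⟨a, b⟩, hp⟩ := IsCompact.nonempty_iInter_of_directed_nonempty_isCompact_isClosed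
    (fun K : c => P K) (fun K L => by
      rcases hchain.total K.2 L.2 with h | h
      · exact ⟨K, subset_rfl, hPmono _ _ h⟩
      · exact ⟨L, hPmono _ _ h, subset_rfl⟩)
    (fun K => hPne K K.2) (fun K => (hPclosed K K.2).isCompact) (fun K => hPclosed K K.2)
  rw [mem_iInter] at hp
  have h0 := hp ⟨K₀, hK₀⟩
  refine ⟨a, b, h0.1.1.1.1.1, h0.1.1.1.1.2, fun K hK => (hp ⟨K, hK⟩).1.1.1.2,
    fun K hK => (hp ⟨K, hK⟩).1.1.2, h0.1.2, fun z hz h => ?_⟩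
  rcases mem_iInter₂.1 h0.2 z hz with h' | h'
  · exact absurd h.1 (not_lt.2 h')
  · exact absurd h.2 (not_lt.2 h')

/-- As `a` and `b` lie in `K`, no gap of `K` straddles either of them, so the gaps outside `Ioo a b`
survive. -/
theorem IsShortcut.diff_Ioo {σ : unitInterval → X} {K : Set unitInterval} (hK : IsShortcut σ K)
    {a b : unitInterval} (ha : a ∈ K) (hb : b ∈ K) (h : σ a = σ b) :
    IsShortcut σ (K \ Ioo a b) := by
  refine ⟨hK.isClosed.sdiff isOpen_Ioo, fun x => ?_⟩
  obtain ⟨a', b', hax, hxb, ha', hb', hab', hgap⟩ := hK.exists_gap x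
  rcases lt_or_ge x a with hx | hx
  · have hb'a : b' ≤ a := not_lt.1 fun h' => hgap a ha ⟨hax.trans_lt hx, h'⟩
    exact ⟨a', b', hax, hxb, ⟨ha', fun h' => (hax.trans hx.le).not_gt h'.1⟩,
      ⟨hb', fun h' => hb'a.not_gt h'.1⟩, hab', fun c hc => hgap c hc.1⟩
  rcases lt_or_ge b x with hx' | hx'
  · have hb'a : b ≤ a' := not_lt.1 fun h' => hgap b hb ⟨h', hx'.trans_le hxb⟩
    exact ⟨a', b', hax, hxb, ⟨ha', fun h' => hb'a.not_gt h'.2⟩,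
      ⟨hb', fun h' => (hx'.le.trans hxb).not_gt h'.2⟩, hab', fun c hc => hgap c hc.1⟩
  · exact ⟨a, b, hx, hx', ⟨ha, fun h' => lt_irrefl _ h'.1⟩, ⟨hb, fun h' => lt_irrefl _ h'.2⟩, h,
      fun c hc h' => hc.2 h'⟩

variable [TopologicalSpace X]

theorem exists_isShortcut_minimal [T2Space X] {σ : unitInterval → X} (hσ : Continuous σ) :
    ∃ K, IsShortcut σ K ∧ ∀ a ∈ K, ∀ b ∈ K, σ a = σ b → ∀ c ∈ K, ¬ (a < c ∧ c < b) := by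
  obtain ⟨K, -, hK⟩ := zorn_superset_nonempty {K | IsShortcut σ K}
    (fun c hc hchain hne => ⟨⋂₀ c, IsShortcut.sInter hσ hc hchain hne,
      fun _ hs => sInter_subset_of_mem hs⟩) univ (isShortcut_univ σ)
  refine ⟨K, hK.prop, fun a ha b hb hab c hc hacb => ?_⟩
  exact (hK.le_of_le (hK.prop.diff_Ioo ha hb hab) sdiff_subset hc).2 hacb

/-- Every path in a Hausdorff space can be shortened to a path with order-connected fibres. -/
theorem exists_shortening [T2Space X] {σ : unitInterval → X} (hσ : Continuous σ) :
    ∃ l : unitInterval → unitInterval, Continuous (σ ∘ l) ∧ σ (l 0) = σ 0 ∧ σ (l 1) = σ 1 ∧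
      (∀ x, σ (l (l x)) = σ (l x)) ∧
      ∀ x y z, x ≤ z → z ≤ y → σ (l x) = σ (l y) → σ (l z) = σ (l x) := by
  obtain ⟨K, hK, hmin⟩ := exists_isShortcut_minimal hσ
  choose l r hl hr hlK hrK hlr hgap using hK.exists_gap
  have hfix : ∀ x ∈ K, σ (l x) = σ x := fun x hx => by
    rcases (hl x).lt_or_eq with h | h
    · rcases (hr x).lt_or_eq with h' | h'
      · exact absurd ⟨h, h'⟩ (hgap x x hx)
      · rw [hlr, ← h']
    · rw [h]
  refine ⟨l, continuous_iff_continuousAt.2 fun x => ?_, ?_, ?_, fun x => hfix _ (hlK x), ?_⟩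
  · by_cases hx : x ∈ K
    · rw [ContinuousAt, Function.comp_apply, hfix x hx]
      refine Filter.tendsto_def.2 fun U hU => ?_
      have hright : ∀ᶠ y in 𝓝 x, Icc x y ⊆ σ ⁻¹' U :=
        Filter.tendsto_smallSets_iff.1 (tendsto_const_nhds.Icc Filter.tendsto_id) _
          (hσ.continuousAt hU)
      have hleft : ∀ᶠ y in 𝓝 x, Icc y x ⊆ σ ⁻¹' U :=
        Filter.tendsto_smallSets_iff.1 (Filter.tendsto_id.Icc tendsto_const_nhds) _
          (hσ.continuousAt hU)
      filter_upwards [hright, hleft] with y hxy hyx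
      -- The time `l y` may be far from `x`, but then `r y`, which has the same image, lies between
      -- `y` and `x`.
      rcases lt_or_ge (l y) x with h | h
      · have h' : r y ≤ x := not_lt.1 fun h' => hgap y x hx ⟨h, h'⟩
        rw [mem_preimage, Function.comp_apply, hlr]
        exact hyx ⟨hr y, h'⟩
      · exact hxy ⟨h, hl y⟩
    -- Off `K`, the function `l` is constant on the gap around `x`.
    · have h1 : l x < x := (hl x).lt_of_ne fun h => hx (h ▸ hlK x)
      have h2 : x < r x := (hr x).lt_of_ne fun h => hx (h ▸ hrK x)
      refine (continuousAt_const (y := σ (l x))).congr ?_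
      filter_upwards [Ioo_mem_nhds h1 h2] with y hy
      have h3 : l y ≤ l x := not_lt.1 fun h => hgap x _ (hlK y) ⟨h, (hl y).trans_lt hy.2⟩
      have h4 : l x ≤ l y := not_lt.1 fun h => hgap y _ (hlK x) ⟨h, hy.1.trans_le (hr y)⟩
      rw [Function.comp_apply, le_antisymm h3 h4]
  · rw [le_antisymm (hl 0) unitInterval.nonneg']
  · rw [hlr, le_antisymm unitInterval.le_one' (hr 1)]
  · intro x y z hxz hzy hxy
    -- By minimality no time of `K` lies strictly between `l x` and `r y`, so an end of the gap at
    -- `z` is one of these two.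
    have hab : σ (l x) = σ (r y) := hxy.trans (hlr y)
    have hno := hmin _ (hlK x) _ (hrK y) hab
    have h1 : l x ≤ z := (hl x).trans hxz
    have h2 : z ≤ r y := hzy.trans (hr y)
    rcases lt_or_ge (l x) (l z) with h | h
    · have : r y ≤ l z := not_lt.1 fun h' => hno _ (hlK z) ⟨h, h'⟩
      rw [hab, le_antisymm ((hl z).trans h2) this]
    · rcases h.lt_or_eq with h | h
      · have : r z ≤ l x := not_lt.1 fun h' => hgap z _ (hlK x) ⟨h, h'⟩
        rw [hlr z, le_antisymm this (h1.trans (hr z))]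
      · rw [h]

/-! ### Monotone functions with the fibres of a path -/

section Reparametrisation

variable {τ : unitInterval → X}

/-- The running maximum from time `p` on of a function that is constant on the order-connected
fibres of `τ`. -/
theorem exists_monotone_lt [T2Space X] (hτ : Continuous τ)
    (hfib : ∀ x y z, x ≤ z → z ≤ y → τ x = τ y → τ z = τ x) (p q : unitInterval) :
    ∃ M : unitInterval → ℝ, Continuous M ∧ Monotone M ∧ (∀ x, 0 ≤ M x ∧ M x ≤ 1) ∧
      (∀ x y, τ x = τ y → M x = M y) ∧ (p < q → τ p ≠ τ q → M p < M q) := by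
  by_cases hpq : p < q ∧ τ p ≠ τ q
  swap
  · exact ⟨fun _ => 0, continuous_const, monotone_const, by simp, by simp,
      fun h h' => absurd ⟨h, h'⟩ hpq⟩
  obtain ⟨hpq, hne⟩ := hpq
  -- The space `X` need not be normal, but the compact Hausdorff space `range τ` is, so Urysohn's
  -- lemma applies there.
  have : CompactSpace (range τ) := isCompact_iff_compactSpace.1 (isCompact_range hτ)
  obtain ⟨f, hf0, hf1, hf⟩ := exists_continuous_zero_one_of_isClosed
    (s := {(⟨τ p, p, rfl⟩ : range τ)}) (t := {⟨τ q, q, rfl⟩}) isClosed_singleton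
    isClosed_singleton (by simpa [Subtype.ext_iff] using hne)
  let g : unitInterval → ℝ := fun x => f ⟨τ x, x, rfl⟩
  have hg : Continuous g := f.continuous.comp (hτ.subtype_mk _)
  have hgp : g p = 0 := hf0 rfl
  have hgq : g q = 1 := hf1 rfl
  have hgτ : ∀ x y, τ x = τ y → g x = g y := fun x y h => by simp only [g, h]
  -- The times `max p (min y x)` fill `[p, x]`, or only `{p}` if `x ≤ p`. Letting `y` range over a
  -- fixed compact set makes the supremum continuous in `x`.
  let S : unitInterval → Set ℝ := fun x => (fun y => g (max p (min y x))) '' univ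
  have hbdd : ∀ x, BddAbove (S x) := fun x => ⟨1, by rintro _ ⟨y, -, rfl⟩; exact (hf _).2⟩
  have hSne : ∀ x, (S x).Nonempty := fun x => ⟨_, 0, trivial, rfl⟩
  have hmem : ∀ x y, g (max p (min y x)) ∈ S x := fun x y => ⟨y, trivial, rfl⟩
  have hmono : ∀ x y, x ≤ y → S x ⊆ S y := by
    rintro x y h _ ⟨z, -, rfl⟩
    have := hmem y (min z x)
    rwa [min_assoc, min_eq_left h] at this
  -- Here `τ` is constant on `[x, y]`, so `g` takes no new value there.
  have hfibS : ∀ x y, x ≤ y → τ x = τ y → S y ⊆ S x := by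
    rintro x y h hxy _ ⟨z, -, rfl⟩
    rcases le_total z x with hz | hz
    · have := hmem x z
      rw [min_eq_left hz] at this
      simpa [min_eq_left (hz.trans h)] using this
    have key : g (max p (min z y)) = g (max p (min x x)) := by
      have hw : x ≤ min z y := le_min hz h
      have hw' : min z y ≤ y := min_le_right _ _
      rw [min_self]
      generalize min z y = w at hw hw'
      rcases le_total p x with hp | hp
      · rw [max_eq_right hp, max_eq_right (hp.trans hw)]
        exact hgτ _ _ (hfib x y w hw hw' hxy)
      · rw [max_eq_left hp]
        rcases le_total p w with hp' | hp'
        · rw [max_eq_right hp']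
          exact hgτ _ _ ((hfib x y w hw hw' hxy).trans (hfib x y p hp (hp'.trans hw') hxy).symm)
        · rw [max_eq_left hp']
    show g (max p (min z y)) ∈ S x
    rw [key]
    exact hmem x x
  have hM : Continuous fun x => sSup (S x) := by
    refine isCompact_univ.continuous_sSup ?_
    exact hg.comp (continuous_const.max (continuous_snd.min continuous_fst))
  refine ⟨fun x => sSup (S x), hM, fun x y h => csSup_le_csSup (hbdd y) (hSne x) (hmono x y h),
    fun x => ⟨?_, csSup_le (hSne x) ?_⟩, fun x y h => ?_, fun _ _ => ?_⟩
  · exact le_csSup_of_le (hbdd x) (hmem x 0) (hf _).1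
  · rintro _ ⟨y, -, rfl⟩
    exact (hf _).2
  · rcases le_total x y with h' | h'
    · exact congrArg sSup ((hmono x y h').antisymm (hfibS x y h' h))
    · exact congrArg sSup ((hfibS y x h' h.symm).antisymm (hmono y x h'))
  · have h1 : sSup (S p) ≤ 0 := csSup_le (hSne p) (by
      rintro _ ⟨y, -, rfl⟩
      simp only [max_eq_left (min_le_right y p), hgp, le_refl])
    have h2 : 1 ≤ sSup (S q) := le_csSup_of_le (hbdd q) (hmem q q) (by
      rw [min_self, max_eq_right hpq.le, hgq])
    exact h1.trans_lt (zero_lt_one.trans_le h2)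

/-- Because of this, countably many pairs `(p, q)` suffice, and the functions of
`exists_monotone_lt` can be summed. -/
theorem exists_denseSeq_between [T2Space X] (hτ : Continuous τ) {x y : unitInterval} (hxy : x < y)
    (hne : τ x ≠ τ y) : ∃ i j, x ≤ TopologicalSpace.denseSeq unitInterval i ∧
      TopologicalSpace.denseSeq unitInterval i < TopologicalSpace.denseSeq unitInterval j ∧
      TopologicalSpace.denseSeq unitInterval j ≤ y ∧
      τ (TopologicalSpace.denseSeq unitInterval i) ≠
        τ (TopologicalSpace.denseSeq unitInterval j) := by
  obtain ⟨U, V, hU, hV, hxU, hyV, hUV⟩ := t2_separation hne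
  obtain ⟨m, hxm, hmy⟩ := exists_between hxy
  have : (𝓝[>] x).NeBot := nhdsGT_neBot_of_exists_gt ⟨y, hxy⟩
  have : (𝓝[<] y).NeBot := nhdsLT_neBot_of_exists_lt ⟨x, hxy⟩
  have h1 : (τ ⁻¹' U ∩ Ioo x m).Nonempty := Filter.nonempty_of_mem (f := 𝓝[>] x)
    (Filter.inter_mem (mem_nhdsWithin_of_mem_nhds ((hU.preimage hτ).mem_nhds hxU))
      (Ioo_mem_nhdsGT hxm))
  have h2 : (τ ⁻¹' V ∩ Ioo m y).Nonempty := Filter.nonempty_of_mem (f := 𝓝[<] y)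
    (Filter.inter_mem (mem_nhdsWithin_of_mem_nhds ((hV.preimage hτ).mem_nhds hyV))
      (Ioo_mem_nhdsLT hmy))
  obtain ⟨i, hi⟩ := (TopologicalSpace.denseRange_denseSeq unitInterval).exists_mem_open
    ((hU.preimage hτ).inter isOpen_Ioo) h1
  obtain ⟨j, hj⟩ := (TopologicalSpace.denseRange_denseSeq unitInterval).exists_mem_open
    ((hV.preimage hτ).inter isOpen_Ioo) h2
  exact ⟨i, j, hi.2.1.le, hi.2.2.trans hj.2.1, hj.2.2.le,
    fun h => disjoint_left.1 hUV hi.1 (h ▸ hj.1)⟩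

theorem exists_monotone_real [T2Space X] (hτ : Continuous τ)
    (hfib : ∀ x y z, x ≤ z → z ≤ y → τ x = τ y → τ z = τ x) :
    ∃ φ : unitInterval → ℝ, Continuous φ ∧ Monotone φ ∧ ∀ x y, φ x = φ y ↔ τ x = τ y := by
  choose M hMc hMm hMb hMτ hMlt using exists_monotone_lt hτ hfib
  let d := TopologicalSpace.denseSeq unitInterval
  let F : ℕ → unitInterval → ℝ := fun n x =>
    (1 / 2 : ℝ) ^ n * M (d n.unpair.1) (d n.unpair.2) x
  have hpos : ∀ n, (0 : ℝ) < (1 / 2) ^ n := fun n => by positivity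
  have hF0 : ∀ n x, 0 ≤ F n x := fun n x => mul_nonneg (hpos n).le (hMb _ _ x).1
  have hF1 : ∀ n x, F n x ≤ (1 / 2) ^ n := fun n x =>
    mul_le_of_le_one_right (hpos n).le (hMb _ _ x).2
  have hsum : ∀ x, Summable fun n => F n x := fun x =>
    Summable.of_nonneg_of_le (hF0 · x) (hF1 · x) summable_geometric_two
  have hFm : ∀ n x y, x ≤ y → F n x ≤ F n y := fun n x y h =>
    mul_le_mul_of_nonneg_left (hMm _ _ h) (hpos n).le
  have hlt : ∀ x y, x < y → τ x ≠ τ y → ∑' n, F n x < ∑' n, F n y := fun x y hxy hne => by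
    obtain ⟨i, j, hxi, hij, hjy, hd⟩ := exists_denseSeq_between hτ hxy hne
    refine Summable.tsum_lt_tsum (i := Nat.pair i j) (fun n => hFm n x y hxy.le) ?_ (hsum x)
      (hsum y)
    refine mul_lt_mul_of_pos_left ?_ (hpos _)
    simp only [Nat.unpair_pair]
    exact (hMm _ _ hxi).trans_lt ((hMlt _ _ hij hd).trans_le (hMm _ _ hjy))
  refine ⟨fun x => ∑' n, F n x, ?_, fun x y h => (hsum x).tsum_le_tsum (hFm · x y h) (hsum y),
    fun x y => ⟨fun h => ?_, fun h => ?_⟩⟩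
  · refine continuous_tsum (fun n => continuous_const.mul (hMc _ _)) summable_geometric_two
      fun n x => ?_
    rw [Real.norm_of_nonneg (hF0 n x)]
    exact hF1 n x
  · by_contra hne
    rcases lt_trichotomy x y with h' | h' | h'
    · exact (hlt x y h' hne).ne h
    · exact hne (h' ▸ rfl)
    · exact (hlt y x h' (Ne.symm hne)).ne h.symm
  · exact tsum_congr fun n => by simp only [F, hMτ _ _ x y h]

end Reparametrisation

/-! ### The arc -/

/-- A path with distinct end points in a Hausdorff space contains an arc that traverses its
points in the same order. -/
theorem exists_strictMono_isEmbedding_comp [T2Space X] {σ : unitInterval → X} (hσ : Continuous σ)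
    (hne : σ 0 ≠ σ 1) : ∃ ψ : unitInterval → unitInterval, StrictMono ψ ∧ IsEmbedding (σ ∘ ψ) ∧
      σ (ψ 0) = σ 0 ∧ σ (ψ 1) = σ 1 := by
  obtain ⟨l, hl, hl0, hl1, hll, hfib⟩ := exists_shortening hσ
  obtain ⟨φ, hφ, hφm, hφl⟩ := exists_monotone_real hl hfib
  simp only [Function.comp_apply] at hφl
  have h01 : φ 0 < φ 1 := (hφm unitInterval.nonneg').lt_of_ne fun h => hne (by rw [← hl0, ← hl1, (hφl 0 1).1 h])
  have hsurj : ∀ a : unitInterval, ∃ x, φ x = φ 0 + a * (φ 1 - φ 0) := fun a => by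
    have : φ 0 + a * (φ 1 - φ 0) ∈ Icc (φ 0) (φ 1) := by
      constructor <;> nlinarith [a.2.1, a.2.2]
    obtain ⟨x, -, hx⟩ := intermediate_value_Icc (a := (0 : unitInterval)) (b := 1) unitInterval.nonneg'
      hφ.continuousOn this
    exact ⟨x, hx⟩
  -- A right inverse of the rescaled `φ`; it need not be continuous.
  choose u hu using hsurj
  have hφψ : ∀ a, φ (l (u a)) = φ 0 + a * (φ 1 - φ 0) := fun a => by
    rw [← hu a]
    exact (hφl _ _).2 (hll _)
  have hψ : StrictMono (l ∘ u) := fun a b hab => by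
    refine hφm.reflect_lt ?_
    simp only [Function.comp_apply, hφψ]
    have : (a : ℝ) < b := hab
    nlinarith
  have hinj : Function.Injective (σ ∘ (l ∘ u)) := fun a b hab => by
    have h := (hφl (u a) (u b)).2 hab
    rw [hu, hu] at h
    have := mul_right_cancel₀ (sub_pos.2 h01).ne' (add_left_cancel h)
    exact Subtype.ext this
  have hcont : Continuous (σ ∘ (l ∘ u)) := by
    -- The rescaled `φ` is a quotient map with the fibres of `σ ∘ l`, and `σ ∘ l ∘ u` is the induced
    -- map on the quotient.
    have hq : IsQuotientMap fun x => (⟨(φ x - φ 0) / (φ 1 - φ 0),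
        div_nonneg (sub_nonneg.2 (hφm unitInterval.nonneg')) (sub_pos.2 h01).le,
        (div_le_one (sub_pos.2 h01)).2 (sub_le_sub_right (hφm unitInterval.le_one') _)⟩ : unitInterval) := by
      refine IsQuotientMap.of_surjective_continuous (fun a => ⟨u a, ?_⟩) ?_
      · apply Subtype.ext
        simp [hu, (sub_pos.2 h01).ne']
      · exact ((hφ.sub continuous_const).div_const _).subtype_mk _
    refine hq.continuous_iff.2 (hl.congr fun x => ?_)
    refine (hφl _ _).1 ?_
    rw [hu]
    simp [(sub_pos.2 h01).ne']
  refine ⟨l ∘ u, hψ, (hcont.isClosedEmbedding hinj).isEmbedding, ?_, ?_⟩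
  · rw [← hl0]
    exact (hφl _ _).1 (by simp [hu])
  · rw [← hl1]
    exact (hφl _ _).1 (by simp [hu])

end ArcOfPath

namespace MultiDigraph

open Topology

variable {V E : Type*} {G : MultiDigraph V E}

/-! ### Components of `G - S` and ends -/

theorem JoinedOff.left_notMem {S : Finset V} {u v : V} (h : G.JoinedOff S u v) : u ∉ S :=
  h.choose_spec _ h.choose.start_mem_support

theorem Joins.joinedOff {S : Finset V} {e : E} {u v : V} (h : G.Joins e u v) (hu : u ∉ S)
    (hv : v ∉ S) : G.JoinedOff S u v := by
  have hadj : G.adjGraph.Adj u v := ⟨e, h⟩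
  refine ⟨SimpleGraph.Walk.cons hadj SimpleGraph.Walk.nil, fun w hw => ?_⟩
  have hw' : w = u ∨ w = v := by simpa using hw
  rcases hw' with rfl | rfl
  · exact hu
  · exact hv

theorem joins_tail_head (G : MultiDigraph V E) (e : E) : G.Joins e (G.tail e) (G.head e) :=
  Or.inl ⟨rfl, rfl⟩

/-- Equivalent rays have tails in the same component of `G - S`, so any one ray of the end decides.
-/
theorem mem_endComp_toEnd {S : Finset V} {R : G.Ray} {v : V} :
    v ∈ G.endComp S R.toEnd ↔ ∃ N : ℕ, ∀ n ≥ N, G.JoinedOff S v (R.vert n) := by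
  refine ⟨?_, fun h => ⟨R, rfl, h⟩⟩
  rintro ⟨R', hR', N, hN⟩
  have heq : R'.Equivalent R := Quotient.exact hR'
  obtain ⟨M, hM⟩ := heq S
  exact ⟨M, fun n hn => (hN (max N M) (le_max_left _ _)).trans
    (hM (max N M) (le_max_right _ _) n hn)⟩

theorem notMem_of_mem_endComp {S : Finset V} {ω : G.Ends} {v : V} (h : v ∈ G.endComp S ω) :
    v ∉ S := by
  obtain ⟨R, -, N, hN⟩ := h
  exact (hN N le_rfl).left_notMem

theorem mem_endComp_of_joinedOff {S : Finset V} {ω : G.Ends} {u v : V} (h : v ∈ G.endComp S ω)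
    (huv : G.JoinedOff S u v) : u ∈ G.endComp S ω := by
  obtain ⟨R, hR, N, hN⟩ := h
  exact ⟨R, hR, N, fun n hn => huv.trans (hN n hn)⟩

theorem endComp_subset_of_mem {S : Finset V} {ω ω' : G.Ends} {v : V} (h : v ∈ G.endComp S ω)
    (h' : v ∈ G.endComp S ω') : G.endComp S ω ⊆ G.endComp S ω' := by
  intro u hu
  obtain ⟨R, rfl⟩ := Quotient.exists_rep ω
  obtain ⟨N, hN⟩ := mem_endComp_toEnd.1 h
  obtain ⟨M, hM⟩ := mem_endComp_toEnd.1 hu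
  exact mem_endComp_of_joinedOff h' ((hM (max N M) (le_max_right _ _)).trans
    (hN (max N M) (le_max_left _ _)).symm)

theorem endComp_eq_of_mem {S : Finset V} {ω ω' : G.Ends} {v : V} (h : v ∈ G.endComp S ω)
    (h' : v ∈ G.endComp S ω') : G.endComp S ω = G.endComp S ω' :=
  (endComp_subset_of_mem h h').antisymm (endComp_subset_of_mem h' h)

/-- If the components agreed for every `S`, tails of both rays would always share a component,
making the rays equivalent. -/
theorem exists_endComp_ne {ω ω' : G.Ends} (h : ω ≠ ω') :
    ∃ S : Finset V, G.endComp S ω ≠ G.endComp S ω' := by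
  by_contra! hcon
  obtain ⟨R, rfl⟩ := Quotient.exists_rep ω
  obtain ⟨R', rfl⟩ := Quotient.exists_rep ω'
  refine h (Quotient.sound fun S => ?_)
  obtain ⟨N, hN⟩ := Ray.equivalent_refl R S
  have hmem : R.vert N ∈ G.endComp S R.toEnd :=
    mem_endComp_toEnd.2 ⟨N, fun n hn => hN N le_rfl n hn⟩
  obtain ⟨M, hM⟩ := mem_endComp_toEnd.1 ((hcon S).subset hmem)
  exact ⟨max N M, fun m hm n hn => (hN m (le_trans (le_max_left _ _) hm) N le_rfl).trans
    (hM n (le_trans (le_max_right _ _) hn))⟩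

/-! ### Basic open sets -/

theorem isOpen_image_inner (G : MultiDigraph V E) (e : E) {J : Set (Set.Ioo (0 : ℝ) 1)}
    (hJ : IsOpen J) : IsOpen (Point.inner (G := G) e '' J) :=
  TopologicalSpace.isOpen_generateFrom_of_mem (Or.inl (Or.inl ⟨e, J, hJ, rfl⟩))

theorem isOpen_openStar (G : MultiDigraph V E) (v : V) {ε : E → ℝ} (hε : ∀ e, 0 < ε e) :
    IsOpen (G.openStar v ε) :=
  TopologicalSpace.isOpen_generateFrom_of_mem (Or.inl (Or.inr ⟨v, ε, hε, rfl⟩))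

theorem isOpen_endNhd (G : MultiDigraph V E) (S : Finset V) (ω : G.Ends) :
    IsOpen (G.endNhd S ω) :=
  TopologicalSpace.isOpen_generateFrom_of_mem (Or.inr ⟨S, ω, rfl⟩)

@[simp]
theorem vertex_mem_openStar {u v : V} {ε : E → ℝ} :
    (Point.vertex u : G.Point) ∈ G.openStar v ε ↔ u = v := by
  simp [openStar]

@[simp]
theorem limit_notMem_openStar {ω : G.Ends} {v : V} {ε : E → ℝ} :
    (Point.limit ω : G.Point) ∉ G.openStar v ε := by
  simp [openStar]

@[simp]
theorem inner_mem_openStar {e : E} {x : Set.Ioo (0 : ℝ) 1} {v : V} {ε : E → ℝ} :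
    (Point.inner e x : G.Point) ∈ G.openStar v ε ↔
      (G.tail e = v ∧ (x : ℝ) < ε e) ∨ (G.head e = v ∧ 1 - (x : ℝ) < ε e) := by
  constructor
  · rintro ((h | ⟨e', x', h, h'⟩) | ⟨e', x', h, h'⟩)
    · cases h
    · cases h
      exact Or.inl h'
    · cases h
      exact Or.inr h'
  · rintro (h | h)
    · exact Or.inl (Or.inr ⟨e, x, rfl, h⟩)
    · exact Or.inr ⟨e, x, rfl, h⟩

@[simp]
theorem vertex_mem_endNhd {v : V} {S : Finset V} {ω : G.Ends} :
    (Point.vertex v : G.Point) ∈ G.endNhd S ω ↔ v ∈ G.endComp S ω := by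
  simp [endNhd]

@[simp]
theorem limit_mem_endNhd {S : Finset V} {ω ω' : G.Ends} :
    (Point.limit ω' : G.Point) ∈ G.endNhd S ω ↔ G.endComp S ω' = G.endComp S ω := by
  simp [endNhd]

@[simp]
theorem inner_mem_endNhd {e : E} {x : Set.Ioo (0 : ℝ) 1} {S : Finset V} {ω : G.Ends} :
    (Point.inner e x : G.Point) ∈ G.endNhd S ω ↔
      G.tail e ∈ G.endComp S ω ∨ G.head e ∈ G.endComp S ω := by
  constructor
  · rintro ((⟨v, -, h⟩ | ⟨e', x', h, h'⟩) | ⟨ω', h, -⟩)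
    · cases h
    · cases h
      exact h'
    · cases h
  · exact fun h => Or.inl (Or.inr ⟨e, x, rfl, h⟩)

/-- The vertex `v` together with all its neighbours is a finite set. -/
theorem LocallyFinite.exists_finset (hG : G.LocallyFinite) (v : V) :
    ∃ S : Finset V, ∀ e, (G.tail e = v ∨ G.head e = v) → G.tail e ∈ S ∧ G.head e ∈ S := by
  classical
  refine ⟨(hG v).toFinset.image G.tail ∪ (hG v).toFinset.image G.head, fun e he => ?_⟩
  have : e ∈ (hG v).toFinset := (hG v).mem_toFinset.2 he
  exact ⟨Finset.mem_union_left _ (Finset.mem_image_of_mem _ this),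
    Finset.mem_union_right _ (Finset.mem_image_of_mem _ this)⟩

/-! ### The Hausdorff property -/

/-- The two points have disjoint open neighbourhoods. -/
def Separated (p q : G.Point) : Prop :=
  ∃ U W : Set G.Point, IsOpen U ∧ IsOpen W ∧ p ∈ U ∧ q ∈ W ∧ Disjoint U W

theorem Separated.symm {p q : G.Point} (h : Separated p q) : Separated q p := by
  obtain ⟨U, W, hU, hW, hp, hq, hd⟩ := h
  exact ⟨W, U, hW, hU, hq, hp, hd.symm⟩

theorem separated_vertex_vertex {u v : V} (h : u ≠ v) :
    Separated (Point.vertex u : G.Point) (Point.vertex v) := by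
  -- With radius `1 / 2` the stars do not meet even on an edge between `u` and `v`.
  refine ⟨G.openStar u fun _ => 1 / 2, G.openStar v fun _ => 1 / 2,
    isOpen_openStar _ _ (by simp), isOpen_openStar _ _ (by simp), by simp, by simp,
    Set.disjoint_left.2 ?_⟩
  rintro (w | ⟨e, x⟩ | ω) h1 h2
  · exact h ((vertex_mem_openStar.1 h1).symm.trans (vertex_mem_openStar.1 h2))
  · rw [inner_mem_openStar] at h1 h2
    rcases h1 with ⟨h1, h1'⟩ | ⟨h1, h1'⟩ <;> rcases h2 with ⟨h2, h2'⟩ | ⟨h2, h2'⟩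
    · exact h (h1.symm.trans h2)
    · linarith
    · linarith
    · exact h (h1.symm.trans h2)
  · exact limit_notMem_openStar h1

theorem separated_vertex_inner (v : V) (e : E) (x : Set.Ioo (0 : ℝ) 1) :
    Separated (Point.vertex v : G.Point) (Point.inner e x) := by
  have hx0 : (0 : ℝ) < x := x.2.1
  have hx1 : (x : ℝ) < 1 := x.2.2
  have hm : 0 < min (x : ℝ) (1 - x) := lt_min hx0 (by linarith)
  refine ⟨G.openStar v fun _ => min (x : ℝ) (1 - x) / 2, Point.inner e ''
    {y | min (x : ℝ) (1 - x) / 2 < y ∧ min (x : ℝ) (1 - x) / 2 < 1 - (y : ℝ)},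
    isOpen_openStar _ _ fun _ => half_pos hm, isOpen_image_inner _ _ ?_, by simp,
    ⟨x, ⟨(half_lt_self hm).trans_le (min_le_left _ _),
      (half_lt_self hm).trans_le (min_le_right _ _)⟩, rfl⟩, Set.disjoint_left.2 ?_⟩
  · exact (isOpen_lt continuous_const continuous_subtype_val).inter
      (isOpen_lt continuous_const (continuous_const.sub continuous_subtype_val))
  · rintro _ h1 ⟨y, hy, rfl⟩
    rcases inner_mem_openStar.1 h1 with ⟨-, h⟩ | ⟨-, h⟩
    · exact lt_asymm h hy.1
    · exact lt_asymm h hy.2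

theorem separated_inner_inner {e e' : E} {x x' : Set.Ioo (0 : ℝ) 1}
    (h : (Point.inner e x : G.Point) ≠ Point.inner e' x') :
    Separated (Point.inner e x : G.Point) (Point.inner e' x') := by
  by_cases he : e = e'
  · subst he
    obtain ⟨U, W, hU, hW, hx, hx', hd⟩ := t2_separation fun h' : x = x' => h (h' ▸ rfl)
    refine ⟨_, _, isOpen_image_inner _ e hU, isOpen_image_inner _ e hW, ⟨x, hx, rfl⟩,
      ⟨x', hx', rfl⟩, Set.disjoint_left.2 ?_⟩
    rintro _ ⟨y, hy, rfl⟩ ⟨y', hy', h'⟩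
    cases h'
    exact Set.disjoint_left.1 hd hy hy'
  · refine ⟨_, _, isOpen_image_inner _ e isOpen_univ, isOpen_image_inner _ e' isOpen_univ,
      ⟨x, trivial, rfl⟩, ⟨x', trivial, rfl⟩, Set.disjoint_left.2 ?_⟩
    rintro _ ⟨y, hy, rfl⟩ ⟨y', hy', h'⟩
    cases h'
    exact he rfl

theorem LocallyFinite.separated_vertex_limit (hG : G.LocallyFinite) (v : V) (ω : G.Ends) :
    Separated (Point.vertex v : G.Point) (Point.limit ω) := by
  classical
  obtain ⟨S, hS⟩ := hG.exists_finset v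
  -- All edges at `v` have both ends in `S`, so none has an end in the component of `ω`. The vertex
  -- `v` is inserted because `S` need not contain it if no edge is incident with it.
  refine ⟨G.openStar v fun _ => 1, G.endNhd (insert v S) ω, isOpen_openStar _ _ (by simp),
    isOpen_endNhd _ _ _, by simp, by simp, Set.disjoint_left.2 ?_⟩
  rintro (w | ⟨e, x⟩ | ω') h1 h2
  · rw [vertex_mem_openStar] at h1
    exact notMem_of_mem_endComp (vertex_mem_endNhd.1 h2) (by simp [h1])
  · have he := hS e ((inner_mem_openStar.1 h1).imp And.left And.left)
    rcases inner_mem_endNhd.1 h2 with h | h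
    · exact notMem_of_mem_endComp h (Finset.mem_insert_of_mem he.1)
    · exact notMem_of_mem_endComp h (Finset.mem_insert_of_mem he.2)
  · exact limit_notMem_openStar h1

theorem separated_inner_limit (e : E) (x : Set.Ioo (0 : ℝ) 1) (ω : G.Ends) :
    Separated (Point.inner e x : G.Point) (Point.limit ω) := by
  classical
  refine ⟨_, G.endNhd {G.tail e, G.head e} ω, isOpen_image_inner _ e isOpen_univ,
    isOpen_endNhd _ _ _, ⟨x, trivial, rfl⟩, by simp, Set.disjoint_left.2 ?_⟩
  rintro _ ⟨y, -, rfl⟩ h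
  rcases inner_mem_endNhd.1 h with h | h
  · exact notMem_of_mem_endComp h (by simp)
  · exact notMem_of_mem_endComp h (by simp)

/-- An edge with inner points in both neighbourhoods has an end in each component; if these ends
differ, both avoid `S` and the edge joins the components. -/
theorem separated_limit_limit {ω ω' : G.Ends} (h : ω ≠ ω') :
    Separated (Point.limit ω : G.Point) (Point.limit ω') := by
  obtain ⟨S, hS⟩ := exists_endComp_ne h
  refine ⟨G.endNhd S ω, G.endNhd S ω', isOpen_endNhd _ _ _, isOpen_endNhd _ _ _, by simp, by simp,
    Set.disjoint_left.2 ?_⟩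
  rintro (w | ⟨e, x⟩ | ω₁) h1 h2
  · exact hS (endComp_eq_of_mem (vertex_mem_endNhd.1 h1) (vertex_mem_endNhd.1 h2))
  · rw [inner_mem_endNhd] at h1 h2
    have hj := G.joins_tail_head e
    rcases h1 with h1 | h1 <;> rcases h2 with h2 | h2
    · exact hS (endComp_eq_of_mem h1 h2)
    · exact hS (endComp_eq_of_mem h1 (mem_endComp_of_joinedOff h2
        (hj.joinedOff (notMem_of_mem_endComp h1) (notMem_of_mem_endComp h2))))
    · exact hS (endComp_eq_of_mem h1 (mem_endComp_of_joinedOff h2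
        (hj.joinedOff (notMem_of_mem_endComp h2) (notMem_of_mem_endComp h1)).symm))
    · exact hS (endComp_eq_of_mem h1 h2)
  · exact hS ((limit_mem_endNhd.1 h1).symm.trans (limit_mem_endNhd.1 h2))

/-- The Freudenthal compactification of a locally finite graph is a Hausdorff space. -/
theorem LocallyFinite.t2Space (hG : G.LocallyFinite) : T2Space G.Point := by
  refine ⟨fun p q h => ?_⟩
  change Separated p q
  rcases p with u | ⟨e, x⟩ | ω <;> rcases q with v | ⟨e', x'⟩ | ω'
  · exact separated_vertex_vertex fun h' => h (h' ▸ rfl)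
  · exact separated_vertex_inner u e' x'
  · exact hG.separated_vertex_limit u ω'
  · exact (separated_vertex_inner v e x).symm
  · exact separated_inner_inner h
  · exact separated_inner_limit e x ω'
  · exact (hG.separated_vertex_limit v ω).symm
  · exact (separated_inner_limit e' x' ω).symm
  · exact separated_limit_limit fun h' => h (h' ▸ rfl)

end MultiDigraph

/-! ### The directed arc -/

theorem corollary3p3 {V E : Type*} (G : MultiDigraph V E) (hfin : G.LocallyFinite)
    (hconn : G.WeaklyConnected) (s t : G.Point) (hs : s ∈ G.verticesAndEnds)
    (ht : t ∈ G.verticesAndEnds) (hst : s ≠ t) (W : Set G.Point)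
    (lt : ↥(G.innerPoints ∩ W) → ↥(G.innerPoints ∩ W) → Prop)
    (hW : G.IsDirectedTopWalk W lt s t) :
    ∃ A : Set G.Point, A ⊆ W ∧ G.IsDirectedArc A s t := by
  have := hfin.t2Space
  obtain ⟨hdir, σ, hσ, rfl, rfl⟩ := hW
  obtain ⟨ψ, hψ, hemb, h0, h1⟩ := ArcOfPath.exists_strictMono_isEmbedding_comp σ.continuous hst
  have hsub : Set.range (σ ∘ ψ) ⊆ W := by
    rw [← hσ.range_eq]
    exact Set.range_comp_subset_range ψ σ
  let ι : ↥(G.innerPoints ∩ Set.range (σ ∘ ψ)) → ↥(G.innerPoints ∩ W) :=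
    Set.inclusion (Set.inter_subset_inter_right _ hsub)
  have hι : Function.Injective ι := Set.inclusion_injective _
  have := hσ.isStrictTotalOrder
  let α : C(unitInterval, G.Point) := ⟨σ ∘ ψ, hemb.continuous⟩
  refine ⟨Set.range (σ ∘ ψ), hsub, fun p q => lt (ι p) (ι q),
    fun e p q hp hq => hdir e (ι p) (ι q) hp hq, α, hemb, ⟨?_, rfl, ?_, ?_⟩, h0, h1⟩
  · exact (RelEmbedding.preimage ⟨ι, hι⟩ lt).isStrictTotalOrder
  · rintro p ⟨-, a, ha⟩
    exact ⟨a, ha, fun b hb => hemb.injective (hb.trans ha.symm)⟩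
  · intro p q
    rw [hσ.lt_iff]
    constructor
    · rintro ⟨a, b, ha, hb, hab⟩
      obtain ⟨a', ha'⟩ := p.2.2
      obtain ⟨b', hb'⟩ := q.2.2
      -- Inner points are visited only once by `σ`, so the times `a` and `b` are those at which the
      -- arc visits them.
      have haa : a = ψ a' := (hσ.existsUnique_preimage _ (ι p).2).unique ha ha'
      have hbb : b = ψ b' := (hσ.existsUnique_preimage _ (ι q).2).unique hb hb'
      rw [haa, hbb] at hab
      exact ⟨a', b', ha', hb', hψ.lt_iff_lt.1 hab⟩
    · rintro ⟨a, b, ha, hb, hab⟩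
      exact ⟨ψ a, ψ b, ha, hb, hψ hab⟩
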